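/- Let $k \ge 2$ be an integer and let $G$ be a finite simple undirected graph with $m$ edges and maximum degree $\Delta$. Let $\lambda_1$ be the largest eigenvalue of the adjacency matrix of $G$. Suppose that $G$ is not bipartite and that $G$ contains none of the cycles $C_3, C_5, \ldots, C_{2k+1}$ as a (not necessarily induced) subgraph. Then $m\Delta^{2k-2} - \left(2\cos\frac{\pi}{k+2}\right)^{2k} \ge 0$, and $$\lambda_1 < \left( m\,\Delta^{2k-2} - \left(2\cos\frac{\pi}{k+2}\right)^{2k} \right)^{1/(2k)}.$$ -/

import Mathlib

namespace SimpleGraph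

/-- The largest eigenvalue `λ₁(G)` of the (real) adjacency matrix of a finite graph `G`. -/
noncomputable def largestAdjEigenvalue {V : Type*} [Fintype V] [DecidableEq V]
    (G : SimpleGraph V) [DecidableRel G.Adj] : ℝ :=
  sSup (spectrum ℝ (G.adjMatrix ℝ))

/-- On a nonempty vertex set the supremum is attained: `λ₁(G)` is the greatest eigenvalue. -/
theorem isGreatest_largestAdjEigenvalue {V : Type*} [Fintype V] [DecidableEq V] [Nonempty V]
    (G : SimpleGraph V) [DecidableRel G.Adj] :
    IsGreatest (spectrum ℝ (G.adjMatrix ℝ)) G.largestAdjEigenvalue := by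
  have hA : (G.adjMatrix ℝ).IsHermitian := by
    rw [Matrix.IsHermitian, Matrix.conjTranspose_eq_transpose_of_trivial]
    exact G.isSymm_adjMatrix
  have hs := hA.spectrum_real_eq_range_eigenvalues
  have hfin : (spectrum ℝ (G.adjMatrix ℝ)).Finite := by
    rw [hs]; exact Set.finite_range _
  have hne : (spectrum ℝ (G.adjMatrix ℝ)).Nonempty := by
    rw [hs]; exact Set.range_nonempty _
  exact ⟨hne.csSup_mem hfin, fun _ hx => le_csSup hfin.bddAbove hx⟩

end SimpleGraph

namespace SimpleGraph

/-- The segment of a walk between its `i`-th and `j`-th vertices. -/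
theorem Walk.exists_walk_getVert {V : Type*} {G : SimpleGraph V} {u v : V} (w : G.Walk u v)
    {i j : ℕ} (hij : i ≤ j) (hj : j ≤ w.length) :
    ∃ p : G.Walk (w.getVert i) (w.getVert j), p.length = j - i := by
  refine ⟨((w.drop i).take (j - i)).copy rfl ?_, ?_⟩
  · rw [Walk.drop_getVert, Nat.add_sub_cancel' hij]
  · simp; omega

/-- The complementary segment of a closed walk. -/
theorem Walk.exists_walk_getVert_compl {V : Type*} {G : SimpleGraph V} {u : V} (w : G.Walk u u)
    {i j : ℕ} (hij : i ≤ j) (hj : j ≤ w.length) :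
    ∃ p : G.Walk (w.getVert j) (w.getVert i), p.length = w.length - (j - i) :=
  ⟨(w.drop j).append (w.take i), by simp; omega⟩

/-- In a closed walk whose length is minimal among odd closed walks, the vertices are distinct and
the only adjacencies are between cyclically consecutive ones. -/
theorem Walk.chord_of_minimal_odd {V : Type*} {G : SimpleGraph V} {u : V} (w : G.Walk u u)
    (hw : Odd w.length) (hmin : ∀ v (p : G.Walk v v), Odd p.length → w.length ≤ p.length)
    {i j : ℕ} (hij : i < j) (hj : j < w.length) :
    w.getVert i ≠ w.getVert j ∧
      (G.Adj (w.getVert i) (w.getVert j) → j = i + 1 ∨ i = 0 ∧ j + 1 = w.length) := by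
  obtain ⟨p, hp⟩ := w.exists_walk_getVert hij.le hj.le
  obtain ⟨q, hq⟩ := w.exists_walk_getVert_compl hij.le hj.le
  constructor
  · intro h
    have h1 := hmin _ (p.copy rfl h.symm)
    have h2 := hmin _ (q.copy rfl h)
    simp only [Walk.length_copy, hp, hq] at h1 h2
    grind
  · intro h
    have h1 := hmin _ (Walk.cons h.symm p)
    have h2 := hmin _ (Walk.cons h q)
    simp only [Walk.length_cons, hp, hq] at h1 h2
    grind

/-- A non-bipartite graph has a shortest odd cycle, which is induced and is no longer than any
closed walk of odd length. -/
theorem exists_induced_odd_cycle {V : Type*} {G : SimpleGraph V} (hG : ¬ G.IsBipartite) :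
    ∃ l : ℕ, 1 ≤ l ∧ (∀ v (p : G.Walk v v), Odd p.length → 2 * l + 1 ≤ p.length) ∧
      ∃ f : Fin (2 * l + 1) → V, Function.Injective f ∧
        ∀ s t, G.Adj (f s) (f t) ↔ (cycleGraph (2 * l + 1)).Adj s t := by
  classical
  have hex : ∃ n, Odd n ∧ ∃ u, ∃ w : G.Walk u u, w.length = n := by
    by_contra! h
    refine hG (two_colorable_iff_forall_loop_even.2 fun u w ↦ ?_)
    rw [← Nat.not_odd_iff_even]
    exact fun ho ↦ h _ ho u w rfl
  obtain ⟨hodd, u, w, hw⟩ := Nat.find_spec hex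
  have hmin : ∀ v (p : G.Walk v v), Odd p.length → Nat.find hex ≤ p.length :=
    fun v p hp ↦ Nat.find_min' hex ⟨hp, v, p, rfl⟩
  obtain ⟨l, hl⟩ := hodd
  rw [hl] at hw hmin
  have hl1 : 1 ≤ l := by
    by_contra h0
    have h1 : w.length = 1 := by omega
    exact G.irrefl (Walk.adj_of_length_eq_one h1)
  have key : ∀ {i j : ℕ}, i < j → j < w.length → _ :=
    fun hij hj ↦ w.chord_of_minimal_odd ⟨l, hw⟩ (by rwa [hw]) hij hj
  refine ⟨l, hl1, hmin, fun s ↦ w.getVert s, ?_, ?_⟩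
  · intro s t hst
    by_contra hne
    rcases lt_or_gt_of_ne (fun h ↦ hne (Fin.ext h) : (s : ℕ) ≠ t) with h | h
    · exact (key h (by omega)).1 hst
    · exact (key h (by omega)).1 hst.symm
  · have main : ∀ s t : Fin (2 * l + 1), s < t →
        (G.Adj (w.getVert s) (w.getVert t) ↔ (cycleGraph (2 * l + 1)).Adj s t) := by
      intro s t hst
      have hst' : (s : ℕ) < t := hst
      have e1 : (t - s : Fin (2 * l + 1)).val = t - s := Fin.sub_val_of_le hst.le
      have e2 : (s - t : Fin (2 * l + 1)).val = 2 * l + 1 + s - t := Fin.coe_sub_iff_lt.2 hst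
      rw [cycleGraph_adj', e1, e2]
      constructor
      · intro h
        have := (key hst' (by omega)).2 h
        omega
      · rintro (h | h)
        · have hs : (s : ℕ) = 0 := by omega
          have ht : (t : ℕ) + 1 = w.length := by omega
          have := w.adj_getVert_succ (i := t) (by omega)
          rw [ht, w.getVert_length] at this
          rw [hs, w.getVert_zero]
          exact this.symm
        · have ht : (t : ℕ) = s + 1 := by omega
          rw [ht]
          exact w.adj_getVert_succ (by omega)
    intro s t
    rcases lt_trichotomy s t with h | h | h
    · exact main s t h
    · subst h; simp
    · rw [G.adj_comm, (cycleGraph _).adj_comm]; exact main t s h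

end SimpleGraph

section Spectral

open Matrix

theorem Matrix.IsHermitian.trace_pow_eq_sum_eigenvalues {n : Type*} [Fintype n] [DecidableEq n]
    {A : Matrix n n ℝ} (hA : A.IsHermitian) (p : ℕ) :
    (A ^ p).trace = ∑ i, hA.eigenvalues i ^ p := by
  conv_lhs => rw [hA.spectral_theorem]
  rw [← map_pow, Matrix.diagonal_pow, Unitary.conjStarAlgAut_apply, Matrix.trace_mul_cycle,
    Unitary.coe_star_mul_self, one_mul, Matrix.trace_diagonal]
  simp

theorem Matrix.IsHermitian.sum_sq_eigenvectorBasis_dotProduct {n : Type*} [Fintype n]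
    [DecidableEq n] {A : Matrix n n ℝ} (hA : A.IsHermitian) (x : n → ℝ) :
    ∑ i, ((hA.eigenvectorBasis i).ofLp ⬝ᵥ x) ^ 2 = x ⬝ᵥ x := by
  have := hA.eigenvectorBasis.sum_inner_mul_inner (WithLp.toLp 2 x) (WithLp.toLp 2 x)
  simp only [EuclideanSpace.inner_eq_star_dotProduct, star_trivial] at this
  rw [← this]
  refine Finset.sum_congr rfl fun i _ ↦ ?_
  rw [dotProduct_comm x, sq]

theorem Matrix.IsHermitian.dotProduct_mulVec_eq_sum {n : Type*} [Fintype n]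
    [DecidableEq n] {A : Matrix n n ℝ} (hA : A.IsHermitian) (x : n → ℝ) :
    x ⬝ᵥ A *ᵥ x = ∑ i, hA.eigenvalues i * ((hA.eigenvectorBasis i).ofLp ⬝ᵥ x) ^ 2 := by
  have := hA.eigenvectorBasis.sum_inner_mul_inner (WithLp.toLp 2 x) (WithLp.toLp 2 (A *ᵥ x))
  simp only [EuclideanSpace.inner_eq_star_dotProduct, star_trivial] at this
  rw [dotProduct_comm, ← this]
  refine Finset.sum_congr rfl fun i _ ↦ ?_
  have hT : Aᵀ = A := by
    rw [← conjTranspose_eq_transpose_of_trivial]; exact hA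
  rw [dotProduct_comm (A *ᵥ x), dotProduct_mulVec, ← mulVec_transpose, hT,
    hA.mulVec_eigenvectorBasis, smul_dotProduct, smul_eq_mul]
  ring

theorem Matrix.IsHermitian.dotProduct_mulVec_le {n : Type*} [Fintype n]
    [DecidableEq n] {A : Matrix n n ℝ} (hA : A.IsHermitian) {c : ℝ}
    (hc : ∀ i, hA.eigenvalues i ≤ c) (x : n → ℝ) : x ⬝ᵥ A *ᵥ x ≤ c * (x ⬝ᵥ x) := by
  rw [hA.dotProduct_mulVec_eq_sum, ← hA.sum_sq_eigenvectorBasis_dotProduct, Finset.mul_sum]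
  exact Finset.sum_le_sum fun i _ ↦ mul_le_mul_of_nonneg_right (hc i) (sq_nonneg _)

/-- The eigenvalues of a nonnegative symmetric matrix are dominated in absolute value by its
largest eigenvalue. -/
theorem Matrix.IsHermitian.abs_eigenvalues_le_of_nonneg {n : Type*} [Fintype n]
    [DecidableEq n] {A : Matrix n n ℝ} (hA : A.IsHermitian) (h0 : ∀ i j, 0 ≤ A i j) {c : ℝ}
    (hc : ∀ i, hA.eigenvalues i ≤ c) (i : n) : |hA.eigenvalues i| ≤ c := by
  set u : n → ℝ := (hA.eigenvectorBasis i).ofLp with hu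
  have hunit : u ⬝ᵥ u = 1 := by
    have := hA.eigenvectorBasis.orthonormal.1 i
    have h2 : inner ℝ (hA.eigenvectorBasis i) (hA.eigenvectorBasis i) = (1 : ℝ) := by
      rw [real_inner_self_eq_norm_sq, this]; norm_num
    rwa [EuclideanSpace.inner_eq_star_dotProduct, star_trivial] at h2
  have habs : (fun v ↦ |u v|) ⬝ᵥ (fun v ↦ |u v|) = 1 := by
    rw [← hunit]; simp [dotProduct]
  have hval : u ⬝ᵥ A *ᵥ u = hA.eigenvalues i := by
    rw [hu, hA.mulVec_eigenvectorBasis, dotProduct_smul, ← hu, hunit]; simp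
  have hle := hA.dotProduct_mulVec_le hc fun v ↦ |u v|
  rw [habs, mul_one] at hle
  refine le_trans ?_ hle
  rw [← hval]
  simp only [dotProduct, mulVec, Finset.mul_sum]
  refine (Finset.abs_sum_le_sum_abs _ _).trans (Finset.sum_le_sum fun v _ ↦ ?_)
  refine (Finset.abs_sum_le_sum_abs _ _).trans (Finset.sum_le_sum fun w _ ↦ ?_)
  rw [abs_mul, abs_mul, abs_of_nonneg (h0 v w)]

namespace SimpleGraph

theorem isHermitian_adjMatrix_real {V : Type*} [Fintype V] [DecidableEq V]
    (G : SimpleGraph V) [DecidableRel G.Adj] : (G.adjMatrix ℝ).IsHermitian := by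
  rw [Matrix.IsHermitian, Matrix.conjTranspose_eq_transpose_of_trivial]
  exact G.isSymm_adjMatrix

theorem adjMatrix_pow_apply_nonneg {V : Type*} [Fintype V] [DecidableEq V]
    (G : SimpleGraph V) [DecidableRel G.Adj] (p : ℕ) (u v : V) : 0 ≤ (G.adjMatrix ℝ ^ p) u v := by
  rw [adjMatrix_pow_apply_eq_card_walk]
  positivity

theorem trace_adjMatrix_pow_eq_zero {V : Type*} [Fintype V] [DecidableEq V]
    (G : SimpleGraph V) [DecidableRel G.Adj] (p : ℕ)
    (h : ∀ v (w : G.Walk v v), w.length ≠ p) : (G.adjMatrix ℝ ^ p).trace = 0 := by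
  refine Finset.sum_eq_zero fun v _ ↦ ?_
  rw [Matrix.diag_apply, adjMatrix_pow_apply_eq_card_walk, Nat.cast_eq_zero,
    Fintype.card_eq_zero_iff]
  exact ⟨fun w ↦ h v w.1 w.2⟩

/-- The number of walks with `p + 1` edges is at most `2 * m * Δ ^ p`. -/
theorem sum_adjMatrix_pow_succ_le {V : Type*} [Fintype V] [DecidableEq V]
    (G : SimpleGraph V) [DecidableRel G.Adj] (p : ℕ) :
    ∑ u, ∑ v, (G.adjMatrix ℝ ^ (p + 1)) u v ≤
      2 * (G.edgeFinset.card : ℝ) * (G.maxDegree : ℝ) ^ p := by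
  have hrow : ∀ w, ∑ v, G.adjMatrix ℝ w v = G.degree w := by
    intro w
    simp [adjMatrix_apply, ← card_neighborFinset_eq_degree, neighborFinset_eq_filter]
  induction p with
  | zero =>
    simp only [zero_add, pow_one, pow_zero, mul_one, hrow]
    exact_mod_cast G.sum_degrees_eq_twice_card_edges.le
  | succ p ih =>
    calc ∑ u, ∑ v, (G.adjMatrix ℝ ^ (p + 1 + 1)) u v
        = ∑ u, ∑ w, (G.adjMatrix ℝ ^ (p + 1)) u w * G.degree w := by
          refine Finset.sum_congr rfl fun u _ ↦ ?_
          simp only [pow_succ _ (p + 1), Matrix.mul_apply]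
          rw [Finset.sum_comm]
          simp only [← Finset.mul_sum, hrow]
      _ ≤ ∑ u, ∑ w, (G.adjMatrix ℝ ^ (p + 1)) u w * G.maxDegree :=
          Finset.sum_le_sum fun u _ ↦ Finset.sum_le_sum fun w _ ↦
            mul_le_mul_of_nonneg_left (by exact_mod_cast G.degree_le_maxDegree w)
              (G.adjMatrix_pow_apply_nonneg _ _ _)
      _ = (∑ u, ∑ w, (G.adjMatrix ℝ ^ (p + 1)) u w) * G.maxDegree := by
          simp only [Finset.sum_mul]
      _ ≤ _ := by
          rw [pow_succ (G.maxDegree : ℝ), ← mul_assoc]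
          exact mul_le_mul_of_nonneg_right ih (by positivity)

theorem cycleGraph_sum_adjMatrix_pow {n : ℕ} (p : ℕ) (s : Fin (n + 3)) :
    ∑ t, ((cycleGraph (n + 3)).adjMatrix ℝ ^ p) s t = 2 ^ p := by
  induction p with
  | zero => simp [Matrix.one_apply]
  | succ p ih =>
    simp only [pow_succ, Matrix.mul_apply]
    rw [Finset.sum_comm]
    have hrow : ∀ w, ∑ t, (cycleGraph (n + 3)).adjMatrix ℝ w t = 2 := by
      intro w
      have := congrArg (Nat.cast (R := ℝ)) (cycleGraph_degree_three_le (v := w))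
      simpa [adjMatrix_apply, ← card_neighborFinset_eq_degree, neighborFinset_eq_filter] using this
    simp only [← Finset.mul_sum, hrow, ← Finset.sum_mul, ih]

theorem adjMatrix_cycleGraph_eq_permMatrix_add {n : ℕ} :
    (cycleGraph (n + 3)).adjMatrix ℝ = (Equiv.addRight (1 : Fin (n + 3))).permMatrix ℝ +
      (Equiv.addRight (1 : Fin (n + 3)))⁻¹.permMatrix ℝ := by
  ext s t
  have hne : ¬ (t - s = 1 ∧ s - t = 1) := by
    rintro ⟨h1, h2⟩
    have h : (1 : Fin (n + 3)) + 1 = 0 := by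
      nth_rewrite 1 [← h1]
      rw [← h2]
      simp
    exact ne_of_beq_false rfl h
  have e1 : s + 1 = t ↔ t - s = 1 := by rw [sub_eq_iff_eq_add']; exact eq_comm
  have e2 : s - 1 = t ↔ s - t = 1 := by rw [sub_eq_iff_eq_add', sub_eq_iff_eq_add]
  have e3 : (Equiv.addRight (1 : Fin (n + 3)))⁻¹ s = s - 1 := by
    rw [Equiv.Perm.inv_eq_iff_eq]; simp
  rw [adjMatrix_apply, Matrix.add_apply, Equiv.Perm.permMatrix, Equiv.Perm.permMatrix,
    PEquiv.toMatrix_apply, PEquiv.toMatrix_apply, Equiv.toPEquiv_apply, Equiv.toPEquiv_apply]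
  simp only [cycleGraph_adj, e3, Equiv.coe_addRight, Option.mem_some_iff, e1, e2]
  by_cases h1 : t - s = 1 <;> by_cases h2 : s - t = 1 <;> simp_all

theorem val_addRight_one_pow {n : ℕ} (p : ℕ) (s : Fin (n + 3)) :
    (((Equiv.addRight (1 : Fin (n + 3))) ^ p) s : ℕ) = (s + p) % (n + 3) := by
  induction p with
  | zero => simp [Nat.mod_eq_of_lt s.2]
  | succ p ih =>
    rw [pow_succ', Equiv.Perm.mul_apply, Equiv.coe_addRight, Fin.val_add, ih]
    simp [add_assoc]

/-- A closed walk of even length `2 * k` in an odd cycle of length more than `k` has as many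
forward as backward steps. -/
theorem trace_adjMatrix_cycleGraph_pow_le {n k : ℕ} (hn : Odd (n + 3)) (hk : k < n + 3) :
    ((cycleGraph (n + 3)).adjMatrix ℝ ^ (2 * k)).trace ≤ (n + 3) * k.centralBinom := by
  set σ : Equiv.Perm (Fin (n + 3)) := Equiv.addRight (1 : Fin (n + 3)) with hσ
  have hpow : ∀ (τ : Equiv.Perm (Fin (n + 3))) (p : ℕ),
      τ.permMatrix ℝ ^ p = (τ ^ p).permMatrix ℝ := by
    intro τ p
    induction p with
    | zero => simp
    | succ p ih => rw [pow_succ, ih, pow_succ', Matrix.permMatrix_mul]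
  have hcomm : Commute (σ.permMatrix ℝ) (σ⁻¹.permMatrix ℝ) := by
    rw [Commute, SemiconjBy, ← Matrix.permMatrix_mul, ← Matrix.permMatrix_mul]
    simp
  have hzero : ∀ m ∈ Finset.range (2 * k + 1), m ≠ k →
      (σ.permMatrix ℝ ^ m * σ⁻¹.permMatrix ℝ ^ (2 * k - m) *
        ((2 * k).choose m : Matrix (Fin (n + 3)) (Fin (n + 3)) ℝ)).trace = 0 := by
    intro m hm hmk
    rw [Finset.mem_range] at hm
    rw [← nsmul_eq_mul', Matrix.trace_smul, hpow, hpow, ← Matrix.permMatrix_mul,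
      Matrix.trace_permutation]
    have : Function.fixedPoints ((σ⁻¹ ^ (2 * k - m) * σ ^ m : Equiv.Perm (Fin (n + 3)))) = ∅ := by
      rw [Set.eq_empty_iff_forall_notMem]
      intro s hs
      have hs : (σ⁻¹ ^ (2 * k - m) * σ ^ m) s = s := hs
      rw [Equiv.Perm.mul_apply, inv_pow, Equiv.Perm.inv_eq_iff_eq] at hs
      have hv := congrArg Fin.val hs
      rw [hσ, val_addRight_one_pow, val_addRight_one_pow] at hv
      have hmod : m ≡ 2 * k - m [MOD n + 3] := Nat.ModEq.add_left_cancel' (s : ℕ) hv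
      have h2 : 2 * m ≡ 2 * k [MOD n + 3] := by
        have := hmod.add_left m
        rwa [← two_mul, Nat.add_sub_cancel' (by omega)] at this
      have h3 : m ≡ k [MOD n + 3] :=
        Nat.ModEq.cancel_left_of_coprime (Nat.coprime_two_right.2 hn) h2
      have h4 := Int.eq_zero_of_abs_lt_dvd (Nat.modEq_iff_dvd.1 h3)
        (by rw [abs_lt]; push_cast; constructor <;> omega)
      omega
    rw [this, Set.ncard_empty, Nat.cast_zero, smul_zero]
  rw [adjMatrix_cycleGraph_eq_permMatrix_add, hcomm.add_pow, Matrix.trace_sum,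
    Finset.sum_eq_single_of_mem k (by simp; omega) hzero, ← nsmul_eq_mul', Matrix.trace_smul,
    hpow, hpow, ← Matrix.permMatrix_mul, show 2 * k - k = k by omega, inv_pow, inv_mul_cancel,
    Matrix.permMatrix_one, Matrix.trace_one, Fintype.card_fin, Nat.centralBinom]
  simp only [nsmul_eq_mul, Nat.cast_add, Nat.cast_ofNat]
  exact le_of_eq (mul_comm _ _)

theorem adjMatrix_pow_apply_le_of_injective {V W : Type*} [Fintype V] [DecidableEq V] [Fintype W]
    [DecidableEq W] (G : SimpleGraph V) [DecidableRel G.Adj] (H : SimpleGraph W)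
    [DecidableRel H.Adj] {f : W → V} (hf : Function.Injective f)
    (hadj : ∀ s t, H.Adj s t → G.Adj (f s) (f t)) (p : ℕ) (s t : W) :
    (H.adjMatrix ℝ ^ p) s t ≤ (G.adjMatrix ℝ ^ p) (f s) (f t) := by
  induction p generalizing t with
  | zero => simp [Matrix.one_apply, hf.eq_iff]
  | succ p ih =>
    simp only [pow_succ, Matrix.mul_apply]
    calc ∑ r, (H.adjMatrix ℝ ^ p) s r * H.adjMatrix ℝ r t
        ≤ ∑ r, (G.adjMatrix ℝ ^ p) (f s) (f r) * G.adjMatrix ℝ (f r) (f t) := by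
          refine Finset.sum_le_sum fun r _ ↦ mul_le_mul (ih r) ?_ ?_
            (G.adjMatrix_pow_apply_nonneg _ _ _)
          · by_cases h : H.Adj r t
            · simp [adjMatrix_apply, h, hadj r t h]
            · simp only [adjMatrix_apply, h, if_false]
              split_ifs <;> norm_num
          · rw [adjMatrix_apply]; split_ifs <;> norm_num
      _ = ∑ v ∈ Finset.univ.map ⟨f, hf⟩,
            (G.adjMatrix ℝ ^ p) (f s) v * G.adjMatrix ℝ v (f t) := by
          rw [Finset.sum_map]; rfl
      _ ≤ _ := by
          refine Finset.sum_le_sum_of_subset_of_nonneg (Finset.subset_univ _) fun v _ _ ↦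
            mul_nonneg (G.adjMatrix_pow_apply_nonneg _ _ _) ?_
          rw [adjMatrix_apply]; split_ifs <;> norm_num

theorem sum_adjMatrix_pow_sub_trace {V : Type*} [Fintype V] [DecidableEq V]
    (G : SimpleGraph V) [DecidableRel G.Adj] (p : ℕ) :
    ∑ u, ∑ v, (G.adjMatrix ℝ ^ p) u v - (G.adjMatrix ℝ ^ (p + 1)).trace =
      ∑ u, ∑ v, if G.Adj u v then 0 else (G.adjMatrix ℝ ^ p) u v := by
  simp only [Matrix.trace, Matrix.diag_apply, pow_succ _ p, Matrix.mul_apply,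
    ← Finset.sum_sub_distrib]
  refine Finset.sum_congr rfl fun u _ ↦ Finset.sum_congr rfl fun v _ ↦ ?_
  by_cases h : G.Adj u v
  · simp [adjMatrix_apply, h, h.symm]
  · simp [adjMatrix_apply, h, mt (fun h' : G.Adj v u ↦ h'.symm) h]

/-- The walks of length `p` with nonadjacent endpoints in an induced subgraph are among those in the
whole graph. -/
theorem sum_adjMatrix_pow_sub_trace_mono {V W : Type*} [Fintype V] [DecidableEq V] [Fintype W]
    [DecidableEq W] (G : SimpleGraph V) [DecidableRel G.Adj] (H : SimpleGraph W)
    [DecidableRel H.Adj] {f : W → V} (hf : Function.Injective f)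
    (hadj : ∀ s t, G.Adj (f s) (f t) ↔ H.Adj s t) (p : ℕ) :
    ∑ s, ∑ t, (H.adjMatrix ℝ ^ p) s t - (H.adjMatrix ℝ ^ (p + 1)).trace ≤
      ∑ u, ∑ v, (G.adjMatrix ℝ ^ p) u v - (G.adjMatrix ℝ ^ (p + 1)).trace := by
  have hnonneg : ∀ u v, 0 ≤ if G.Adj u v then 0 else (G.adjMatrix ℝ ^ p) u v := by
    intro u v
    split_ifs
    exacts [le_rfl, G.adjMatrix_pow_apply_nonneg _ _ _]
  rw [sum_adjMatrix_pow_sub_trace, sum_adjMatrix_pow_sub_trace]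
  calc ∑ s, ∑ t, (if H.Adj s t then 0 else (H.adjMatrix ℝ ^ p) s t)
      ≤ ∑ s, ∑ t, (if G.Adj (f s) (f t) then 0 else (G.adjMatrix ℝ ^ p) (f s) (f t)) := by
        refine Finset.sum_le_sum fun s _ ↦ Finset.sum_le_sum fun t _ ↦ ?_
        simp only [hadj]
        split_ifs
        exacts [le_rfl, G.adjMatrix_pow_apply_le_of_injective H hf (fun s t ↦ (hadj s t).2) p s t]
    _ = ∑ u ∈ Finset.univ.map ⟨f, hf⟩, ∑ v ∈ Finset.univ.map ⟨f, hf⟩,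
          (if G.Adj u v then 0 else (G.adjMatrix ℝ ^ p) u v) := by
        simp only [Finset.sum_map]; rfl
    _ ≤ ∑ u ∈ Finset.univ.map ⟨f, hf⟩, ∑ v,
          (if G.Adj u v then 0 else (G.adjMatrix ℝ ^ p) u v) :=
        Finset.sum_le_sum fun u _ ↦ Finset.sum_le_sum_of_subset_of_nonneg (Finset.subset_univ _)
          fun v _ _ ↦ hnonneg u v
    _ ≤ _ := Finset.sum_le_sum_of_subset_of_nonneg (Finset.subset_univ _)
          fun u _ _ ↦ Finset.sum_nonneg fun v _ ↦ hnonneg u v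

/-- An induced odd cycle of length more than `k` improves the bound `2 * m * Δ ^ (2 * k - 2)`
for the number of closed walks of length `2 * k`. -/
theorem trace_adjMatrix_pow_le_of_induced_cycle {V : Type*} [Fintype V] [DecidableEq V]
    (G : SimpleGraph V) [DecidableRel G.Adj] {k n : ℕ} (hk : 1 ≤ k) (hn : Odd n) (hn3 : 3 ≤ n)
    (hkn : k < n) {f : Fin n → V} (hf : Function.Injective f)
    (hadj : ∀ s t, G.Adj (f s) (f t) ↔ (cycleGraph n).Adj s t) :
    (G.adjMatrix ℝ ^ (2 * k)).trace + n * (2 ^ (2 * k - 1) - k.centralBinom) ≤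
      2 * ((G.edgeFinset.card : ℝ) * (G.maxDegree : ℝ) ^ (2 * k - 2)) := by
  obtain ⟨n, rfl⟩ := Nat.exists_eq_add_of_le' hn3
  have h1 := G.sum_adjMatrix_pow_succ_le (2 * k - 2)
  have h2 := G.sum_adjMatrix_pow_sub_trace_mono (cycleGraph (n + 3)) hf hadj (2 * k - 1)
  have h3 := trace_adjMatrix_cycleGraph_pow_le hn hkn
  rw [show 2 * k - 2 + 1 = 2 * k - 1 by omega] at h1
  rw [show 2 * k - 1 + 1 = 2 * k by omega] at h2
  simp only [cycleGraph_sum_adjMatrix_pow, Finset.sum_const, Finset.card_univ, Fintype.card_fin,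
    nsmul_eq_mul] at h2
  push_cast at h2 ⊢
  linarith

end SimpleGraph

end Spectral

/-- If the power sum of order `2 * k + 1` of a family of reals vanishes, then the `2 * k`-th power
of a member of largest absolute value makes up at most half of the power sum of order `2 * k`. -/
theorem two_mul_pow_le_sum_pow {ι : Type*} [Fintype ι] {k : ℕ} (hk : 1 ≤ k) (μ : ι → ℝ) {i : ι}
    (hmax : ∀ v, |μ v| ≤ μ i) (hsum : ∑ v, μ v ^ (2 * k + 1) = 0) :
    2 * μ i ^ (2 * k) ≤ ∑ v, μ v ^ (2 * k) := by
  have heven : ∀ v, 0 ≤ μ v ^ (2 * k) := fun v ↦ Even.pow_nonneg ⟨k, by ring⟩ _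
  have hi0 : 0 ≤ μ i := (abs_nonneg _).trans (hmax i)
  rcases hi0.eq_or_lt with h0 | hpos
  · rw [← h0, zero_pow (by omega), mul_zero]
    exact Finset.sum_nonneg fun v _ ↦ heven v
  have hterm := Finset.single_le_sum (f := fun v ↦ μ i * μ v ^ (2 * k) + μ v ^ (2 * k + 1))
    (fun v _ ↦ by
      have := mul_nonneg (by linarith [neg_abs_le (μ v), hmax v] : 0 ≤ μ i + μ v) (heven v)
      rw [pow_succ]
      linarith) (Finset.mem_univ i)
  simp only [Finset.sum_add_distrib, hsum, ← Finset.mul_sum, add_zero] at hterm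
  refine le_of_mul_le_mul_left ?_ hpos
  rw [pow_succ] at hterm
  linarith

theorem Nat.centralBinom_succ_le (k : ℕ) : (k + 1).centralBinom ≤ 4 * k.centralBinom := by
  have := Nat.succ_mul_centralBinom_succ k
  refine Nat.le_of_mul_le_mul_left (c := k + 1) ?_ (by omega)
  nlinarith

theorem Nat.mul_centralBinom_le_four_pow {k : ℕ} (hk : 4 ≤ k) :
    128 * k.centralBinom ≤ 35 * 4 ^ k := by
  induction k, hk using Nat.le_induction with
  | base => decide
  | succ k _ ih =>
    have := Nat.centralBinom_succ_le k
    rw [pow_succ]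
    omega

theorem two_mul_two_mul_cos_pow_lt {k : ℕ} (hk : 2 ≤ k) {n : ℝ} (hn : 2 * k + 3 ≤ n) :
    2 * (2 * Real.cos (Real.pi / ((k : ℝ) + 2))) ^ (2 * k) <
      n * (2 ^ (2 * k - 1) - k.centralBinom) := by
  have hc0 : ∀ k : ℕ, 0 ≤ Real.cos (Real.pi / (k + 2)) := by
    intro k
    have hpi := Real.pi_pos
    apply Real.cos_nonneg_of_mem_Icc
    constructor
    · have : 0 < Real.pi / (k + 2) := by positivity
      linarith
    · exact div_le_div_of_nonneg_left hpi.le (by norm_num) (by linarith [k.cast_nonneg (α := ℝ)])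
  have hcb2 : Nat.centralBinom 2 = 6 := by decide
  have hcb3 : Nat.centralBinom 3 = 20 := by decide
  obtain rfl | rfl | hk4 : k = 2 ∨ k = 3 ∨ 4 ≤ k := by omega
  · rw [hcb2]
    norm_num at hn ⊢
    have h4 : (2 * (√2 / 2)) ^ 4 = (4 : ℝ) := by
      rw [show 2 * (√2 / 2) = √2 by ring, show 4 = 2 * 2 by rfl, pow_mul,
        Real.sq_sqrt (by norm_num)]
      norm_num
    linarith
  · rw [hcb3]
    norm_num at hn ⊢
    have h5 : √5 < 9 / 4 := by
      rw [Real.sqrt_lt' (by norm_num)]; norm_num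
    have : (2 * ((1 + √5) / 4)) ^ 6 ≤ (2 * ((1 + 9 / 4) / 4) : ℝ) ^ 6 := by gcongr
    norm_num at this
    linarith
  · have h1 : (2 * Real.cos (Real.pi / ((k : ℝ) + 2))) ^ (2 * k) ≤ 4 ^ k := by
      rw [show (4 : ℝ) = 2 ^ 2 by norm_num, ← pow_mul]
      exact pow_le_pow_left₀ (by have := hc0 k; positivity)
        (by linarith [Real.cos_le_one (Real.pi / ((k : ℝ) + 2))]) _
    have h2 : (128 * k.centralBinom : ℝ) ≤ 35 * 4 ^ k := by
      exact_mod_cast Nat.mul_centralBinom_le_four_pow hk4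
    have h3 : (2 : ℝ) ^ (2 * k - 1) = 4 ^ k / 2 := by
      rw [eq_div_iff (by norm_num), ← pow_succ, show 2 * k - 1 + 1 = 2 * k by omega, pow_mul]
      norm_num
    have h4 : (4 : ℝ) ≤ k := by exact_mod_cast hk4
    have h5 : (0 : ℝ) < 4 ^ k := by positivity
    rw [h3]
    nlinarith

theorem mainTheorem6 {V : Type*} [Fintype V] [DecidableEq V]
    (G : SimpleGraph V) [DecidableRel G.Adj] (k : ℕ) (hk : 2 ≤ k)
    (hbip : ¬ G.IsBipartite)
    (hfree : ∀ i : ℕ, 1 ≤ i → i ≤ k → (SimpleGraph.cycleGraph (2 * i + 1)).Free G) :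
    0 ≤ (G.edgeFinset.card : ℝ) * (G.maxDegree : ℝ) ^ (2 * k - 2)
          - (2 * Real.cos (Real.pi / ((k : ℝ) + 2))) ^ (2 * k) ∧
    G.largestAdjEigenvalue <
      ((G.edgeFinset.card : ℝ) * (G.maxDegree : ℝ) ^ (2 * k - 2)
          - (2 * Real.cos (Real.pi / ((k : ℝ) + 2))) ^ (2 * k)) ^ (1 / (2 * (k : ℝ))) := by
  obtain ⟨l, hl, hmin, f, hf, hadj⟩ := SimpleGraph.exists_induced_odd_cycle hbip
  have hkl : k + 1 ≤ l := by
    by_contra! hlt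
    exact hfree l hl (by omega) ⟨⟨f, fun {s t} h ↦ (hadj s t).2 h⟩, hf⟩
  have : Nonempty V := ⟨f 0⟩
  have hA := G.isHermitian_adjMatrix_real
  have hgreatest := G.isGreatest_largestAdjEigenvalue
  rw [hA.spectrum_real_eq_range_eigenvalues] at hgreatest
  obtain ⟨⟨i, hi⟩, hub⟩ := hgreatest
  have hle : ∀ v, hA.eigenvalues v ≤ hA.eigenvalues i := fun v ↦ hi ▸ hub ⟨v, rfl⟩
  have habs := hA.abs_eigenvalues_le_of_nonneg (fun u v ↦ by
    rw [SimpleGraph.adjMatrix_apply]; split_ifs <;> norm_num) hle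
  have hsum : ∑ v, hA.eigenvalues v ^ (2 * k + 1) = 0 := by
    rw [← hA.trace_pow_eq_sum_eigenvalues]
    refine G.trace_adjMatrix_pow_eq_zero _ fun v w hw ↦ ?_
    have := hmin v w ⟨k, hw⟩
    omega
  have htrace := G.trace_adjMatrix_pow_le_of_induced_cycle (k := k) (by omega) ⟨l, rfl⟩ (by omega)
    (by omega) hf hadj
  rw [hA.trace_pow_eq_sum_eigenvalues] at htrace
  have hhalf := two_mul_pow_le_sum_pow (by omega) hA.eigenvalues habs hsum
  have hcos := two_mul_two_mul_cos_pow_lt hk (n := (2 * l + 1 : ℕ))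
    (by exact_mod_cast (by omega : 2 * k + 3 ≤ 2 * l + 1))
  have hi0 : 0 ≤ hA.eigenvalues i := (abs_nonneg _).trans (habs i)
  have hlt : hA.eigenvalues i ^ (2 * k) <
      (G.edgeFinset.card : ℝ) * (G.maxDegree : ℝ) ^ (2 * k - 2)
        - (2 * Real.cos (Real.pi / ((k : ℝ) + 2))) ^ (2 * k) := by linarith
  refine ⟨(pow_nonneg hi0 _).trans hlt.le, ?_⟩
  rw [← hi]
  calc hA.eigenvalues i = (hA.eigenvalues i ^ (2 * k)) ^ (1 / (2 * (k : ℝ))) := by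
        have := Real.pow_rpow_inv_natCast hi0 (n := 2 * k) (by omega)
        rw [one_div]
        push_cast at this
        exact this.symm
    _ < _ := Real.rpow_lt_rpow (pow_nonneg hi0 _) hlt (by positivity)
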